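/- All rings are commutative with identity. For a Noetherian ring $A$ and an $A$-module $X$, the set $\operatorname{Coass}_A X$ of coassociated primes of $X$ consists of all primes $P \in \operatorname{Spec} A$ for which there is a nonzero factor module $N$ of $X$ that is hollow (i.e. $N$ is not the sum of two proper submodules) and satisfies $P = \{a \in A \mid aN \neq N\}$. Let $g : R \to S$ be a homomorphism of Noetherian rings, with induced map $g^* : \operatorname{Spec} S \to \operatorname{Spec} R$, $P \mapsto g^{-1}(P)$. Let $L$ be a finitely generated $R$-module, and let $M$ be an $S$-module that is injective as an $R$-module via restriction of scalars along $g$. For an ideal $I$ of $R$ put $(0 :_M I) = \{m \in M \mid g(a)m = 0 \text{ for all } a \in I\}$, an $S$-submodule of $M$, and give $\operatorname{Hom}_R(L,M)$ the $S$-module structure induced by that of $M$. Then: 1. For every $\mathfrak p \in \operatorname{Spec} R$, one has $g^*(\operatorname{Coass}_S (0 :_M \mathfrak p)) = \operatorname{Coass}_R (0 :_M \mathfrak p) \subseteq \{\mathfrak p\}$. 2. $\operatorname{Coass}_S \operatorname{Hom}_R(L,M) = \bigcup_{\mathfrak p \in \operatorname{Ass}_R L} \operatorname{Coass}_S (0 :_M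 \mathfrak p)$. -/

import Mathlib

/-- A module is hollow if it is not the sum of two proper submodules. -/
def IsHollowModule (R N : Type*) [CommRing R] [AddCommGroup N] [Module R N] : Prop :=
  ∀ A B : Submodule R N, A ⊔ B = ⊤ → A = ⊤ ∨ B = ⊤

/-- The coassociated primes of `M`: the primes `P` of `R` for which some nonzero hollow factor
module `N = M ⧸ K` satisfies `P = {a ∈ R | aN ≠ N}`. -/
def coassociatedPrimes (R M : Type*) [CommRing R] [AddCommGroup M] [Module R M] :
    Set (PrimeSpectrum R) :=
  {P | ∃ K : Submodule R M, Nontrivial (M ⧸ K) ∧ IsHollowModule R (M ⧸ K) ∧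
    (P.asIdeal : Set R) = {a : R | LinearMap.range (LinearMap.lsmul R (M ⧸ K) a) ≠ ⊤}}

/-- `(0 :_M I)` for an ideal `I` of `R` and a module `M` over an `R`-algebra `S`, as an
`S`-submodule of `M`. Its `R`-module structure is the one by restriction of scalars. -/
def annihilatedBy {R : Type*} (S M : Type*) [CommRing R] [CommRing S] [Algebra R S]
    [AddCommGroup M] [Module R M] [Module S M] [IsScalarTower R S M] (I : Ideal R) :
    Submodule S M where
  carrier := {m | ∀ a ∈ I, a • m = 0}
  zero_mem' := fun a _ => smul_zero a
  add_mem' := fun {x y} hx hy a ha => by rw [smul_add, hx a ha, hy a ha, add_zero]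
  smul_mem' := fun s x hx a ha => by rw [smul_comm, hx a ha, smul_zero]

universe u v w x

/-! Since `M` is injective over `R`, `Hom_R(-, M)` is exact and turns a prime filtration of `L` into
one of `Hom_R(L, M)` with factors `(0 :_M p)`. An element outside `p` acts surjectively on `(0 :_M
p)` and `p` kills it, so every coassociated prime of that factor contracts to `p`. As coassociated
primes of an extension come from its two ends, any `P` in `Coass Hom_R(L, M)` is coassociated to `(0
:_M q)` for its contraction `q`.

That `q` is associated to `L` follows from passing to `L` modulo the kernel of `L → L_q` and prime
avoidance (`comap_mem_associatedPrimes`). Conversely an embedding `R/p → L` makes `(0 :_M p)` a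
quotient of `Hom_R(L, M)`.

Equality in part 1 also needs nonzero modules over Noetherian rings to have coassociated primes
(`coassociatedPrimes_nonempty`): such a module has a quotient with simple essential socle, which is
Artinian, and nonzero Artinian modules have nonzero hollow quotients. -/

/-! ### Coassociated primes of quotients and extensions -/

section Coassociated

variable {A X Y Z : Type*} [CommRing A] [AddCommGroup X] [Module A X] [AddCommGroup Y]
  [Module A Y] [AddCommGroup Z] [Module A Z]

theorem range_lsmul_eq_top_iff (a : A) :
    LinearMap.range (LinearMap.lsmul A X a) = ⊤ ↔ Function.Surjective fun x : X => a • x :=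
  LinearMap.range_eq_top

theorem smul_surjective_of_surjective {f : X →ₗ[A] Y} (hf : Function.Surjective f) {a : A}
    (h : Function.Surjective fun x : X => a • x) : Function.Surjective fun y : Y => a • y := by
  intro y
  obtain ⟨x, rfl⟩ := hf y
  obtain ⟨x', rfl⟩ := h x
  exact ⟨f x', (map_smul f a x').symm⟩

theorem IsHollowModule.of_surjective {f : X →ₗ[A] Y} (hf : Function.Surjective f)
    (h : IsHollowModule A X) : IsHollowModule A Y := by
  intro B C hBC
  have key : B.comap f ⊔ C.comap f = ⊤ := by
    rw [eq_top_iff]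
    intro x _
    have hx : f x ∈ B ⊔ C := hBC ▸ Submodule.mem_top
    obtain ⟨b, hb, c, hc, hbc⟩ := Submodule.mem_sup.mp hx
    obtain ⟨b', rfl⟩ := hf b
    refine Submodule.mem_sup.mpr ⟨b', hb, x - b', ?_, add_sub_cancel _ _⟩
    rw [Submodule.mem_comap, map_sub, ← hbc, add_sub_cancel_left]
    exact hc
  refine (h _ _ key).imp (fun h' => ?_) fun h' => ?_ <;>
  · rw [eq_top_iff]
    intro y _
    obtain ⟨x, rfl⟩ := hf y
    exact (Submodule.eq_top_iff'.mp h') x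

/-- Coassociated primes can be read off from arbitrary surjections instead of quotients. -/
theorem mem_coassociatedPrimes_of_surjective {P : PrimeSpectrum A} {f : X →ₗ[A] Y}
    (hf : Function.Surjective f) [Nontrivial Y] (hY : IsHollowModule A Y)
    (hP : ∀ a, a ∈ P.asIdeal ↔ ¬ Function.Surjective fun y : Y => a • y) :
    P ∈ coassociatedPrimes A X := by
  let e := f.quotKerEquivOfSurjective hf
  refine ⟨LinearMap.ker f, e.toEquiv.nontrivial, hY.of_surjective (f := e.symm.toLinearMap)
    e.symm.surjective, ?_⟩
  ext a
  rw [SetLike.mem_coe, hP, Set.mem_ofPred_eq, ne_eq, range_lsmul_eq_top_iff, not_iff_not]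
  exact ⟨smul_surjective_of_surjective (f := e.symm.toLinearMap) e.symm.surjective,
    smul_surjective_of_surjective (f := e.toLinearMap) e.surjective⟩

theorem exists_of_mem_coassociatedPrimes {P : PrimeSpectrum A}
    (h : P ∈ coassociatedPrimes A X) : ∃ K : Submodule A X, Nontrivial (X ⧸ K) ∧
      IsHollowModule A (X ⧸ K) ∧
      ∀ a, a ∈ P.asIdeal ↔ ¬ Function.Surjective fun y : X ⧸ K => a • y := by
  obtain ⟨K, h1, h2, h3⟩ := h
  refine ⟨K, h1, h2, fun a => ?_⟩
  rw [← range_lsmul_eq_top_iff, ← SetLike.mem_coe, h3]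
  rfl

theorem coassociatedPrimes_subset_of_surjective {f : X →ₗ[A] Y} (hf : Function.Surjective f) :
    coassociatedPrimes A Y ⊆ coassociatedPrimes A X := by
  intro P hP
  obtain ⟨K, h1, h2, h3⟩ := exists_of_mem_coassociatedPrimes hP
  exact mem_coassociatedPrimes_of_surjective (f := K.mkQ ∘ₗ f)
    (K.mkQ_surjective.comp hf) h2 h3

theorem coassociatedPrimes_eq_of_equiv (e : X ≃ₗ[A] Y) :
    coassociatedPrimes A X = coassociatedPrimes A Y :=
  (coassociatedPrimes_subset_of_surjective (f := e.symm.toLinearMap) e.symm.surjective).antisymm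
    (coassociatedPrimes_subset_of_surjective (f := e.toLinearMap) e.surjective)

theorem coassociatedPrimes_eq_empty [Subsingleton X] : coassociatedPrimes A X = ∅ := by
  rw [Set.eq_empty_iff_forall_notMem]
  rintro P ⟨K, h1, -⟩
  exact not_subsingleton (X ⧸ K) K.mkQ_surjective.subsingleton

theorem notMem_of_smul_surjective {P : PrimeSpectrum A} (hP : P ∈ coassociatedPrimes A X) {a : A}
    (ha : Function.Surjective fun x : X => a • x) : a ∉ P.asIdeal := by
  obtain ⟨K, -, -, h3⟩ := exists_of_mem_coassociatedPrimes hP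
  rw [h3, not_not]
  exact smul_surjective_of_surjective K.mkQ_surjective ha

theorem mem_of_smul_eq_zero {P : PrimeSpectrum A} (hP : P ∈ coassociatedPrimes A X) {a : A}
    (ha : ∀ x : X, a • x = 0) : a ∈ P.asIdeal := by
  obtain ⟨K, h1, -, h3⟩ := exists_of_mem_coassociatedPrimes hP
  rw [h3]
  intro hs
  obtain ⟨y, hy⟩ := exists_ne (0 : X ⧸ K)
  obtain ⟨z, rfl⟩ := hs y
  obtain ⟨x, rfl⟩ := K.mkQ_surjective z
  exact hy (by simp only [← map_smul, ha, map_zero])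

/-- Let `U` be the image of `X` in a hollow quotient `N` of `Y`. If `U = N`, then `N` is a quotient
of `X`. Otherwise `N/U` is a nonzero hollow quotient of `Z` with the same prime, because `aN + U =
N` forces `aN = N`. -/
theorem coassociatedPrimes_subset_union_of_exact {f : X →ₗ[A] Y} {g : Y →ₗ[A] Z}
    (hg : Function.Surjective g) (hfg : Function.Exact f g) :
    coassociatedPrimes A Y ⊆ coassociatedPrimes A X ∪ coassociatedPrimes A Z := by
  intro P hP
  obtain ⟨K, h1, h2, h3⟩ := exists_of_mem_coassociatedPrimes hP
  by_cases hU : LinearMap.range (K.mkQ ∘ₗ f) = ⊤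
  · exact Or.inl (mem_coassociatedPrimes_of_surjective (LinearMap.range_eq_top.mp hU) h2 h3)
  · right
    set U := LinearMap.range (K.mkQ ∘ₗ f)
    have hle : LinearMap.ker g ≤ LinearMap.ker (U.mkQ ∘ₗ K.mkQ) := by
      intro y hy
      obtain ⟨x, rfl⟩ := (hfg y).mp hy
      rw [LinearMap.mem_ker, LinearMap.comp_apply, Submodule.mkQ_apply,
        Submodule.Quotient.mk_eq_zero]
      exact ⟨x, rfl⟩
    let q : Z →ₗ[A] (Y ⧸ K) ⧸ U :=
      (LinearMap.ker g).liftQ (U.mkQ ∘ₗ K.mkQ) hle ∘ₗ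
        (g.quotKerEquivOfSurjective hg).symm.toLinearMap
    have hq : Function.Surjective q := by
      have h : Function.Surjective ((LinearMap.ker g).liftQ (U.mkQ ∘ₗ K.mkQ) hle) := by
        rw [← LinearMap.range_eq_top, Submodule.range_liftQ, LinearMap.range_eq_top]
        exact U.mkQ_surjective.comp K.mkQ_surjective
      exact h.comp (g.quotKerEquivOfSurjective hg).symm.surjective
    have : Nontrivial ((Y ⧸ K) ⧸ U) := Submodule.Quotient.nontrivial_iff.mpr hU
    refine mem_coassociatedPrimes_of_surjective hq (h2.of_surjective U.mkQ_surjective) fun a => ?_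
    rw [h3, not_iff_not]
    refine ⟨smul_surjective_of_surjective U.mkQ_surjective, fun hs => ?_⟩
    have key : LinearMap.range (LinearMap.lsmul A (Y ⧸ K) a) ⊔ U = ⊤ := by
      rw [eq_top_iff]
      intro y _
      obtain ⟨z, hz⟩ := hs (U.mkQ y)
      obtain ⟨w, rfl⟩ := U.mkQ_surjective z
      refine Submodule.mem_sup.mpr ⟨a • w, ⟨w, rfl⟩, y - a • w, ?_, add_sub_cancel _ _⟩
      rw [← Submodule.Quotient.mk_eq_zero, Submodule.Quotient.mk_sub, sub_eq_zero]
      exact hz.symm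
    exact (range_lsmul_eq_top_iff a).mp ((h2 _ _ key).resolve_right hU)

/-- The elements not acting surjectively on a nonzero hollow module form a prime ideal. -/
def IsHollowModule.prime [Nontrivial X] (h : IsHollowModule A X) : PrimeSpectrum A where
  asIdeal :=
    { carrier := {a | ¬ Function.Surjective fun x : X => a • x}
      zero_mem' := fun hs => by
        obtain ⟨x, hx⟩ := exists_ne (0 : X)
        obtain ⟨y, rfl⟩ := hs x
        exact hx (zero_smul _ _)
      add_mem' := fun {a b} ha hb hs => by
        have key : LinearMap.range (LinearMap.lsmul A X a) ⊔
            LinearMap.range (LinearMap.lsmul A X b) = ⊤ := by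
          rw [eq_top_iff]
          intro x _
          obtain ⟨y, rfl⟩ := hs x
          exact Submodule.mem_sup.mpr ⟨a • y, ⟨y, rfl⟩, b • y, ⟨y, rfl⟩, (add_smul a b y).symm⟩
        rcases h _ _ key with h' | h'
        · exact ha ((range_lsmul_eq_top_iff a).mp h')
        · exact hb ((range_lsmul_eq_top_iff b).mp h')
      smul_mem' := fun c a ha hs => ha fun x => by
        obtain ⟨y, rfl⟩ := hs x
        exact ⟨c • y, by simp only [smul_eq_mul, mul_smul, smul_comm a c]⟩ }
  isPrime := by
    refine Ideal.isPrime_iff.mpr ⟨(Ideal.ne_top_iff_one _).mpr fun h1 => ?_, fun {a b} hab => ?_⟩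
    · exact h1 fun x => ⟨x, one_smul _ _⟩
    · by_contra hc
      rw [not_or] at hc
      refine hab ?_
      have := (not_not.mp hc.1).comp (not_not.mp hc.2)
      exact fun x => (this x).imp fun y hy => by simpa only [mul_smul, Function.comp_apply] using hy

theorem coassociatedPrimes_nonempty_of_isHollowModule {f : X →ₗ[A] Y}
    (hf : Function.Surjective f) [Nontrivial Y] (hY : IsHollowModule A Y) :
    (coassociatedPrimes A X).Nonempty :=
  ⟨hY.prime, mem_coassociatedPrimes_of_surjective hf hY fun _ => Iff.rfl⟩

/-- Take `Z` minimal among submodules with `Z + W = X` for some proper `W`. If `X = B + C` with `B,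
C ⊇ W` and `C` proper, the modular law gives `(Z ∩ B) + C = X`, so `Z ≤ B` by minimality and `B =
X`. -/
theorem exists_isHollowModule_quotient_of_isArtinian [Nontrivial X] [IsArtinian A X] :
    ∃ W : Submodule A X, W ≠ ⊤ ∧ IsHollowModule A (X ⧸ W) := by
  let F : Set (Submodule A X) := {Z | ∃ W : Submodule A X, W ≠ ⊤ ∧ Z ⊔ W = ⊤}
  obtain ⟨Z, ⟨W, hW, hZW⟩, hmin⟩ := IsArtinian.set_has_minimal F ⟨⊤, ⊥, bot_ne_top, top_sup_eq _⟩
  refine ⟨W, hW, fun B C hBC => ?_⟩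
  by_contra hc
  rw [not_or] at hc
  have hWB : W ≤ B.comap W.mkQ := by
    intro x hx
    rw [Submodule.mem_comap, Submodule.mkQ_apply, (Submodule.Quotient.mk_eq_zero W).mpr hx]
    exact B.zero_mem
  have hWC : W ≤ C.comap W.mkQ := by
    intro x hx
    rw [Submodule.mem_comap, Submodule.mkQ_apply, (Submodule.Quotient.mk_eq_zero W).mpr hx]
    exact C.zero_mem
  have hsurj := W.mkQ_surjective
  have hCtop : C.comap W.mkQ ≠ ⊤ := fun h => hc.2 <| by
    rw [← Submodule.map_comap_eq_of_surjective hsurj C, h, Submodule.map_top,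
      LinearMap.range_eq_top.mpr hsurj]
  have hsum : B.comap W.mkQ ⊔ C.comap W.mkQ = ⊤ := by
    rw [eq_top_iff]
    intro x _
    have hx : W.mkQ x ∈ B ⊔ C := hBC ▸ Submodule.mem_top
    obtain ⟨b, hb, c, hc, hbc⟩ := Submodule.mem_sup.mp hx
    obtain ⟨b', rfl⟩ := hsurj b
    refine Submodule.mem_sup.mpr ⟨b', hb, x - b', ?_, add_sub_cancel _ _⟩
    rw [Submodule.mem_comap, map_sub, ← hbc, add_sub_cancel_left]
    exact hc
  have hmem : Z ⊓ B.comap W.mkQ ∈ F := by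
    refine ⟨C.comap W.mkQ, hCtop, ?_⟩
    have hB : B.comap W.mkQ = (Z ⊓ B.comap W.mkQ) ⊔ W := by
      rw [inf_comm, inf_sup_assoc_of_le _ hWB, hZW, inf_top_eq]
    rw [eq_top_iff, ← hsum, hB]
    simp only [sup_le_iff]
    exact ⟨⟨by rw [← hB]; exact le_sup_left, hWC.trans le_sup_right⟩, le_sup_right⟩
  have hZB : Z ≤ B.comap W.mkQ := by
    by_contra hn
    exact hmin _ hmem (inf_lt_left.mpr hn)
  refine hc.1 ?_
  rw [← Submodule.map_comap_eq_of_surjective hsurj B,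
    eq_top_iff.mpr (hZW.symm.le.trans (sup_le hZB hWB)), Submodule.map_top,
      LinearMap.range_eq_top.mpr hsurj]

end Coassociated

/-! ### Modules with simple essential socle over a Noetherian ring -/

section Cocyclic

variable {A : Type*} [CommRing A]

theorem IsSimpleModule.exists_eq_smul {Q : Type*} [AddCommGroup Q] [Module A Q]
    [IsSimpleModule A Q] (φ : Q →ₗ[A] Q) : ∃ c : A, ∀ y, φ y = c • y := by
  have := IsSimpleModule.nontrivial A Q
  obtain ⟨y, hy⟩ := exists_ne (0 : Q)
  have hs := IsSimpleModule.toSpanSingleton_surjective A hy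
  obtain ⟨c, hc⟩ := hs (φ y)
  refine ⟨c, fun z => ?_⟩
  obtain ⟨d, rfl⟩ := hs z
  rw [LinearMap.toSpanSingleton_apply] at hc ⊢
  rw [map_smul, ← hc, smul_comm]

/-- A submodule of a finite power of a simple module is cut out by linear equations. -/
theorem IsSimpleModule.exists_sum_smul_ne_zero {Q ι : Type*} [AddCommGroup Q] [Module A Q]
    [IsSimpleModule A Q] [Fintype ι] (D : Submodule A (ι → Q)) {w : ι → Q} (hw : w ∉ D) :
    ∃ c : ι → A, (∀ d ∈ D, ∑ i, c i • d i = 0) ∧ ∑ i, c i • w i ≠ 0 := by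
  classical
  obtain ⟨C, hC⟩ := exists_isCompl D
  let π := C.subtype ∘ₗ C.projectionOnto D hC.symm
  have hπ : ∀ d, π d = 0 ↔ d ∈ D := by
    intro d
    simp [π]
  obtain ⟨j, hj⟩ := Function.ne_iff.mp (mt (hπ w).mp hw)
  choose c hc using fun i =>
    IsSimpleModule.exists_eq_smul (LinearMap.proj j ∘ₗ π ∘ₗ LinearMap.single A (fun _ => Q) i)
  have key : ∀ d, π d j = ∑ i, c i • d i := by
    intro d
    conv_lhs => rw [← Finset.univ_sum_single d]
    rw [map_sum, Finset.sum_apply]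
    exact Finset.sum_congr rfl fun i _ => hc i (d i)
  exact ⟨c, fun d hd => by rw [← key, (hπ d).mpr hd]; rfl, by rw [← key]; exact hj⟩

variable {T : Type*} [AddCommGroup T] [Module A T]

/-- The ideal of the Rees algebra of `I` consisting of the `∑ aₙ tⁿ` such that `aₙ` kills all
elements of `U` killed by `I ^ (n + 1)`. -/
def reesAnnihilator (I : Ideal A) (U : Submodule A T) : Ideal (reesAlgebra I) where
  carrier := {f | ∀ n, ∀ u ∈ U, (∀ a ∈ I ^ (n + 1), a • u = 0) → f.1.coeff n • u = 0}
  zero_mem' n u _ _ := by simp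
  add_mem' {f g} hf hg n u hu h := by simp [add_smul, hf n u hu h, hg n u hu h]
  smul_mem' g f hf n u hu h := by
    rw [smul_eq_mul, MulMemClass.coe_mul, Polynomial.coeff_mul, Finset.sum_smul]
    refine Finset.sum_eq_zero fun ij hij => ?_
    rw [mul_comm, mul_smul]
    -- The degree `i` coefficient of `g` lies in `I ^ i`, so it carries elements killed by `I ^ (n +
    -- 1)` to elements killed by `I ^ (j + 1)`, where `i + j = n`.
    refine hf _ _ (U.smul_mem _ hu) fun a ha => ?_
    rw [smul_smul]
    refine h _ ?_
    rw [← Finset.HasAntidiagonal.mem_antidiagonal.mp hij, add_comm ij.1, add_right_comm, pow_add]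
    exact Ideal.mul_mem_mul ha (g.2 ij.1)

theorem reesAnnihilator_antitone (I : Ideal A) {U V : Submodule A T} (h : U ≤ V) :
    reesAnnihilator I V ≤ reesAnnihilator I U :=
  fun _ hf n u hu => hf n u (h hu)

variable {x : T} (hx : x ≠ 0) (hess : ∀ t : T, t ≠ 0 → x ∈ Submodule.span A {t})

include hx hess in
theorem isSimpleModule_span_of_essential : IsSimpleModule A (Submodule.span A {x}) := by
  rw [isSimpleModule_iff_isAtom]
  refine ⟨by simpa using hx, fun N hN => ?_⟩
  by_contra hne
  obtain ⟨t, htN, ht⟩ := N.ne_bot_iff.mp hne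
  refine hN.not_ge ?_
  rw [Submodule.span_singleton_le_iff_mem]
  exact (Submodule.span_singleton_le_iff_mem t N).mpr htN (hess t ht)

include hx hess in
theorem isMaximal_ker_toSpanSingleton_of_essential :
    Ideal.IsMaximal (LinearMap.ker (LinearMap.toSpanSingleton A T x)) := by
  have := isSimpleModule_span_of_essential hx hess
  rw [Ideal.isMaximal_def, ← isSimpleModule_iff_isCoatom]
  exact IsSimpleModule.congr ((LinearMap.quotKerEquivRange _).trans
    (LinearEquiv.ofEq _ _ (LinearMap.range_toSpanSingleton x)))

include hx hess in
-- Some `c` has `c • t = x`. It lies outside the maximal ideal annihilating `x`, which also kills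
-- `t`, so inverting `c` modulo that ideal recovers `t` from `x`.
theorem mem_span_of_forall_smul_eq_zero {t : T}
    (ht : ∀ a : A, a • x = 0 → a • t = 0) : t ∈ Submodule.span A {x} := by
  by_cases h0 : t = 0
  · rw [h0]; exact zero_mem _
  obtain ⟨c, hc⟩ := Submodule.mem_span_singleton.mp (hess t h0)
  have hm := isMaximal_ker_toSpanSingleton_of_essential hx hess
  have hcm : c ∉ LinearMap.ker (LinearMap.toSpanSingleton A T x) := by
    intro h
    rw [LinearMap.mem_ker, LinearMap.toSpanSingleton_apply] at h
    exact hx (hc ▸ ht c h)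
  obtain ⟨d, a, ha, hda⟩ := hm.exists_inv hcm
  rw [LinearMap.mem_ker, LinearMap.toSpanSingleton_apply] at ha
  refine Submodule.mem_span_singleton.mpr ⟨d, ?_⟩
  rw [← hc, smul_smul, ← sub_eq_zero, ← neg_eq_zero, neg_sub]
  calc t - (d * c) • t = (1 - d * c) • t := by rw [sub_smul, one_smul]
    _ = a • t := by rw [← hda, add_sub_cancel_left]
    _ = 0 := ht a ha

include hx hess in
theorem exists_pow_smul_eq_zero_of_essential [IsNoetherianRing A] (t : T) :
    ∃ n, ∀ a ∈ LinearMap.ker (LinearMap.toSpanSingleton A T x) ^ n, a • t = 0 := by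
  set m := LinearMap.ker (LinearMap.toSpanSingleton A T x) with hm
  have hrad : m ≤ Ideal.radical (LinearMap.ker (LinearMap.toSpanSingleton A T t)) := by
    intro a ha
    rw [hm, LinearMap.mem_ker, LinearMap.toSpanSingleton_apply] at ha
    -- The annihilators of `a ^ n • t` stabilize. If `a ^ n • t ≠ 0`, some `c` sends it to `x`; then
    -- `c` kills `a ^ (n + 1) • t`, hence already `a ^ n • t`, a contradiction.
    let F : ℕ →o Ideal A :=
      { toFun := fun n => LinearMap.ker (LinearMap.toSpanSingleton A T (a ^ n • t))
        monotone' := monotone_nat_of_le_succ fun n b hb => by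
          rw [LinearMap.mem_ker, LinearMap.toSpanSingleton_apply] at hb ⊢
          rw [pow_succ', mul_smul, smul_comm b a, hb, smul_zero] }
    obtain ⟨n, hn⟩ := monotone_stabilizes_iff_noetherian.mpr ‹IsNoetherianRing A› F
    refine ⟨n, ?_⟩
    rw [LinearMap.mem_ker, LinearMap.toSpanSingleton_apply]
    by_contra hne
    obtain ⟨c, hc⟩ := Submodule.mem_span_singleton.mp (hess _ hne)
    have h1 : c ∈ F (n + 1) := by
      change c ∈ LinearMap.ker (LinearMap.toSpanSingleton A T (a ^ (n + 1) • t))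
      rw [LinearMap.mem_ker, LinearMap.toSpanSingleton_apply, pow_succ', mul_smul, smul_comm c a,
        hc, ha]
    rw [← hn (n + 1) n.le_succ] at h1
    exact hx (hc ▸ h1)
  obtain ⟨n, hn⟩ := Ideal.exists_pow_le_of_le_radical_of_fg_radical hrad
    (IsNoetherian.noetherian _)
  exact ⟨n, fun a ha => hn ha⟩

include hx hess in
-- Induction on the power of `m` killing `v`. If `m ^ (n + 1)` kills `v`, generators `f i` of `m ^
-- n` send `v` into the simple socle. Were the tuple `f i • v` not realized by some `u ∈ U`, a
-- separating linear form would give a degree `n` element annihilating for `U` but not for `V`. So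
-- `u` exists, and `v - u` is killed by `m ^ n`.
theorem le_of_reesAnnihilator_le [IsNoetherianRing A] {U V : Submodule A T}
    (h : reesAnnihilator (LinearMap.ker (LinearMap.toSpanSingleton A T x)) U ≤
      reesAnnihilator (LinearMap.ker (LinearMap.toSpanSingleton A T x)) V) (hUV : U ≤ V) :
    V ≤ U := by
  set m := LinearMap.ker (LinearMap.toSpanSingleton A T x) with hm
  suffices H : ∀ n, ∀ v ∈ V, (∀ a ∈ m ^ n, a • v = 0) → v ∈ U by
    intro v hv
    obtain ⟨n, hn⟩ := exists_pow_smul_eq_zero_of_essential hx hess v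
    exact H n v hv hn
  intro n
  induction n with
  | zero =>
    intro v _ h0
    rw [← one_smul A v, h0 1 (by simp)]
    exact U.zero_mem
  | succ n ih =>
    intro v hv hvn
    obtain ⟨r, f, hf⟩ := Submodule.fg_iff_exists_fin_generating_family.mp
      (IsNoetherian.noetherian (m ^ n))
    have hfm : ∀ i, f i ∈ m ^ n := fun i => hf ▸ Submodule.subset_span ⟨i, rfl⟩
    have := isSimpleModule_span_of_essential hx hess
    have hkill : ∀ u : T, (∀ a ∈ m ^ (n + 1), a • u = 0) → ∀ i,
        f i • u ∈ Submodule.span A {x} := by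
      intro u hu i
      refine mem_span_of_forall_smul_eq_zero hx hess fun a ha => ?_
      rw [smul_smul]
      refine hu _ ?_
      rw [pow_succ']
      exact Ideal.mul_mem_mul (by rwa [hm, LinearMap.mem_ker, LinearMap.toSpanSingleton_apply])
        (hfm i)
    let D : Submodule A (Fin r → Submodule.span A {x}) :=
      { carrier := {d | ∃ u ∈ U, (∀ a ∈ m ^ (n + 1), a • u = 0) ∧ ∀ i, (d i : T) = f i • u}
        zero_mem' := ⟨0, U.zero_mem, by simp, by simp⟩
        add_mem' := by
          rintro d d' ⟨u, hu, h1, h2⟩ ⟨u', hu', h1', h2'⟩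
          exact ⟨u + u', U.add_mem hu hu', fun a ha => by rw [smul_add, h1 a ha, h1' a ha, add_zero],
            fun i => by rw [Pi.add_apply, Submodule.coe_add, h2, h2', smul_add]⟩
        smul_mem' := by
          rintro c d ⟨u, hu, h1, h2⟩
          exact ⟨c • u, U.smul_mem c hu, fun a ha => by rw [smul_comm, h1 a ha, smul_zero],
            fun i => by rw [Pi.smul_apply, Submodule.coe_smul, h2, smul_comm]⟩ }
    let w : Fin r → Submodule.span A {x} := fun i => ⟨f i • v, hkill v hvn i⟩
    have hw : w ∈ D := by
      by_contra hw
      obtain ⟨c, hc, hcw⟩ := IsSimpleModule.exists_sum_smul_ne_zero D hw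
      have hb : ∑ i, c i * f i ∈ m ^ n :=
        Ideal.sum_mem _ fun i _ => Ideal.mul_mem_left _ _ (hfm i)
      have hmem : (⟨Polynomial.monomial n (∑ i, c i * f i), reesAlgebra.monomial_mem.mpr hb⟩ :
          reesAlgebra m) ∈ reesAnnihilator m U := by
        intro k u hu hk
        rw [Polynomial.coeff_monomial]
        split_ifs with hnk
        · subst hnk
          have := congrArg Subtype.val (hc (fun i => ⟨f i • u, hkill u hk i⟩)
            ⟨u, hu, hk, fun i => rfl⟩)
          rw [Finset.sum_smul]
          simpa [mul_smul] using this
        · exact zero_smul _ _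
      have := h hmem n v hv hvn
      rw [Polynomial.coeff_monomial, if_pos rfl, Finset.sum_smul] at this
      refine hcw (Subtype.ext ?_)
      simpa [w, mul_smul] using this
    obtain ⟨u, hu, -, hwu⟩ := hw
    have hvu : v - u ∈ U := by
      refine ih _ (V.sub_mem hv (hUV hu)) fun a ha => ?_
      have hle : m ^ n ≤ LinearMap.ker (LinearMap.toSpanSingleton A T (v - u)) := by
        rw [← hf, Submodule.span_le]
        rintro _ ⟨i, rfl⟩
        rw [SetLike.mem_coe, LinearMap.mem_ker, LinearMap.toSpanSingleton_apply, smul_sub, ← hwu i,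
          sub_self]
      exact hle ha
    simpa using U.add_mem hvu hu

include hx hess in
/-- A module over a Noetherian ring with simple essential socle is Artinian. -/
theorem isArtinian_of_essential [IsNoetherianRing A] : IsArtinian A T := by
  set m := LinearMap.ker (LinearMap.toSpanSingleton A T x) with hm
  have hanti : StrictAnti (reesAnnihilator m : Submodule A T → Ideal (reesAlgebra m)) := by
    intro U V hUV
    refine lt_of_le_not_ge (reesAnnihilator_antitone m hUV.le) fun h => ?_
    exact hUV.not_ge (le_of_reesAnnihilator_le hx hess h hUV.le)
  -- The Rees algebra is Noetherian, so its ascending chain condition becomes the descending one on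
  -- submodules of `T`.
  have : WellFoundedGT (Ideal (reesAlgebra m)) := inferInstance
  exact hanti.wellFoundedLT

end Cocyclic

/-- For `K` maximal among the submodules avoiding a fixed `x ≠ 0`, the image of `x` lies in every
nonzero submodule of `X ⧸ K`, which is therefore Artinian. -/
theorem coassociatedPrimes_nonempty {A X : Type*} [CommRing A] [IsNoetherianRing A]
    [AddCommGroup X] [Module A X] [Nontrivial X] : (coassociatedPrimes A X).Nonempty := by
  obtain ⟨x, hx⟩ := exists_ne (0 : X)
  obtain ⟨K, -, hK⟩ := zorn_le_nonempty₀ {K : Submodule A X | x ∉ K} (fun c hc hchain y hy => by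
    refine ⟨sSup c, fun hmem => ?_, fun z hz => le_sSup hz⟩
    obtain ⟨K, hKc, hxK⟩ := (Submodule.mem_sSup_of_directed ⟨y, hy⟩ hchain.directedOn).mp hmem
    exact hc hKc hxK) ⊥ (by simpa using hx)
  have hxK : K.mkQ x ≠ 0 := by
    rw [Submodule.mkQ_apply, ne_eq, Submodule.Quotient.mk_eq_zero]
    exact hK.prop
  have hess : ∀ t : X ⧸ K, t ≠ 0 → K.mkQ x ∈ Submodule.span A {t} := by
    intro t ht
    by_contra hn
    have hle : K ≤ (Submodule.span A {t}).comap K.mkQ := by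
      intro y hy
      rw [Submodule.mem_comap, Submodule.mkQ_apply, (Submodule.Quotient.mk_eq_zero K).mpr hy]
      exact zero_mem _
    have hge := hK.le_of_ge (y := (Submodule.span A {t}).comap K.mkQ) hn hle
    obtain ⟨z, rfl⟩ := K.mkQ_surjective t
    refine ht ((Submodule.Quotient.mk_eq_zero K).mpr (hge ?_))
    exact Submodule.mem_span_singleton_self _
  have := isArtinian_of_essential hxK hess
  have : Nontrivial (X ⧸ K) := ⟨_, _, hxK⟩
  obtain ⟨W, hW, hWh⟩ := exists_isHollowModule_quotient_of_isArtinian (A := A) (X := X ⧸ K)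
  have : Nontrivial ((X ⧸ K) ⧸ W) := Submodule.Quotient.nontrivial_iff.mpr hW
  exact coassociatedPrimes_nonempty_of_isHollowModule (f := W.mkQ ∘ₗ K.mkQ)
    (W.mkQ_surjective.comp K.mkQ_surjective) hWh

/-! ### Homomorphisms into an injective module -/

section HomInjective

variable {R S M : Type*} [CommRing R] [CommRing S] [Algebra R S]
  [AddCommGroup M] [Module R M] [Module S M] [IsScalarTower R S M]

variable (S M) in
/-- Evaluation at `1`, as a map from `Hom_R(R/I, M)` to `(0 :_M I)`. -/
def homQuotientEvalOne (I : Ideal R) : ((R ⧸ I) →ₗ[R] M) →ₗ[S] annihilatedBy S M I where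
  toFun φ := ⟨φ 1, fun a ha => by
    rw [← map_smul, Algebra.smul_def, mul_one, Ideal.Quotient.algebraMap_eq,
      Ideal.Quotient.eq_zero_iff_mem.mpr ha, map_zero]⟩
  map_add' _ _ := rfl
  map_smul' _ _ := rfl

theorem homQuotientEvalOne_bijective (I : Ideal R) :
    Function.Bijective (homQuotientEvalOne S M I) := by
  refine ⟨fun φ ψ h => ?_, fun m => ?_⟩
  · refine LinearMap.ext fun y => ?_
    obtain ⟨r, rfl⟩ := Ideal.Quotient.mk_surjective y
    have hr : Ideal.Quotient.mk I r = r • (1 : R ⧸ I) := by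
      rw [Algebra.smul_def, mul_one, Ideal.Quotient.algebraMap_eq]
    rw [hr, map_smul, map_smul]
    exact congrArg (r • ·) (congrArg Subtype.val h)
  · refine ⟨I.liftQ (LinearMap.toSpanSingleton R M m) fun a ha => m.2 a ha, Subtype.ext ?_⟩
    exact one_smul R (m : M)

variable (S M) in
/-- Evaluation at `1` identifies `Hom_R(R/I, M)` with `(0 :_M I)`. -/
noncomputable def homQuotientEquivAnnihilatedBy (I : Ideal R) :
    ((R ⧸ I) →ₗ[R] M) ≃ₗ[S] annihilatedBy S M I :=
  LinearEquiv.ofBijective (homQuotientEvalOne S M I) (homQuotientEvalOne_bijective I)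

theorem algebraMap_smul_surjective_iff {X : Type*} [AddCommGroup X] [Module R X] [Module S X]
    [IsScalarTower R S X] (a : R) :
    (Function.Surjective fun x : X => algebraMap R S a • x) ↔
      Function.Surjective fun x : X => a • x := by
  simp only [algebraMap_smul]

variable {L L' : Type*} [AddCommGroup L] [Module R L] [AddCommGroup L'] [Module R L']

theorem Module.Baer.lcomp_surjective (hM : Module.Baer R M) {f : L' →ₗ[R] L}
    (hf : Function.Injective f) : Function.Surjective (LinearMap.lcomp S M f) :=
  fun φ => hM.extension_property f hf φ

/-- Multiplication by `a` embeds `L` in itself, and injectivity extends any `φ` along this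
embedding. -/
theorem Module.Baer.smul_hom_surjective (hM : Module.Baer R M) {a : R}
    (ha : IsSMulRegular L a) : Function.Surjective fun φ : L →ₗ[R] M => a • φ := by
  intro φ
  obtain ⟨ψ, hψ⟩ := hM.extension_property (LinearMap.lsmul R L a) ha φ
  refine ⟨ψ, ?_⟩
  rw [← hψ]
  ext y
  simp

theorem lcomp_exact {L'' : Type*} [AddCommGroup L''] [Module R L''] {f : L' →ₗ[R] L}
    {g : L →ₗ[R] L''} (hg : Function.Surjective g) (hfg : Function.Exact f g) :
    Function.Exact (LinearMap.lcomp S M g) (LinearMap.lcomp S M f) := by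
  intro φ
  constructor
  · intro h
    have hle : LinearMap.ker g ≤ LinearMap.ker φ := by
      intro y hy
      obtain ⟨z, rfl⟩ := (hfg y).mp hy
      exact LinearMap.congr_fun h z
    refine ⟨(LinearMap.ker g).liftQ φ hle ∘ₗ (g.quotKerEquivOfSurjective hg).symm.toLinearMap, ?_⟩
    ext y
    have : (g.quotKerEquivOfSurjective hg).symm (g y) = (LinearMap.ker g).mkQ y := by
      rw [LinearEquiv.symm_apply_eq]
      rfl
    simp [this]
  · rintro ⟨ψ, rfl⟩
    ext z
    simp [hfg.apply_apply_eq_zero z]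

theorem smul_annihilatedBy_surjective (hM : Module.Baer R M) {p : Ideal R} (hp : p.IsPrime)
    {a : R} (ha : a ∉ p) : Function.Surjective fun y : annihilatedBy S M p => a • y := by
  have hreg : IsSMulRegular (R ⧸ p) a := by
    rw [isSMulRegular_iff_right_eq_zero_of_smul]
    intro y hy
    rw [Algebra.smul_def, mul_eq_zero, Ideal.Quotient.algebraMap_eq,
      Ideal.Quotient.eq_zero_iff_mem] at hy
    exact hy.resolve_left ha
  rw [← algebraMap_smul_surjective_iff (S := S)]
  refine smul_surjective_of_surjective
    (f := (homQuotientEquivAnnihilatedBy S M p).toLinearMap) (LinearEquiv.surjective _) ?_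
  rw [algebraMap_smul_surjective_iff]
  exact hM.smul_hom_surjective hreg

theorem comap_eq_of_mem_coassociatedPrimes (hM : Module.Baer R M) {p : Ideal R} (hp : p.IsPrime)
    {P : PrimeSpectrum S} (hP : P ∈ coassociatedPrimes S (annihilatedBy S M p)) :
    P.asIdeal.comap (algebraMap R S) = p := by
  ext a
  rw [Ideal.mem_comap]
  constructor
  · intro h
    by_contra ha
    refine notMem_of_smul_surjective hP ?_ h
    rw [algebraMap_smul_surjective_iff]
    exact smul_annihilatedBy_surjective hM hp ha
  · intro ha
    refine mem_of_smul_eq_zero hP fun y => ?_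
    rw [algebraMap_smul]
    exact Subtype.ext (y.2 a ha)

theorem eq_of_mem_coassociatedPrimes_annihilatedBy (hM : Module.Baer R M) {p P : PrimeSpectrum R}
    (hP : P ∈ coassociatedPrimes R (annihilatedBy S M p.asIdeal)) : P = p := by
  refine PrimeSpectrum.ext (Ideal.ext fun a => ⟨fun h => ?_, fun ha => ?_⟩)
  · by_contra ha
    exact notMem_of_smul_surjective hP (smul_annihilatedBy_surjective hM p.isPrime ha) h
  · exact mem_of_smul_eq_zero hP fun y => Subtype.ext (y.2 a ha)

/-- Both sides lie in `{p}`, and both are nonempty unless the module is zero. -/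
theorem comap_image_coassociatedPrimes_annihilatedBy [IsNoetherianRing R] [IsNoetherianRing S]
    (hM : Module.Baer R M) (p : PrimeSpectrum R) :
    PrimeSpectrum.comap (algebraMap R S) '' coassociatedPrimes S (annihilatedBy S M p.asIdeal) =
      coassociatedPrimes R (annihilatedBy S M p.asIdeal) := by
  have hcomap : ∀ P ∈ coassociatedPrimes S (annihilatedBy S M p.asIdeal),
      PrimeSpectrum.comap (algebraMap R S) P = p := fun P hP =>
    PrimeSpectrum.ext (comap_eq_of_mem_coassociatedPrimes hM p.isPrime hP)
  rcases subsingleton_or_nontrivial (annihilatedBy S M p.asIdeal) with h | h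
  · rw [coassociatedPrimes_eq_empty, coassociatedPrimes_eq_empty, Set.image_empty]
  · obtain ⟨P, hP⟩ := coassociatedPrimes_nonempty (A := S) (X := annihilatedBy S M p.asIdeal)
    obtain ⟨Q, hQ⟩ := coassociatedPrimes_nonempty (A := R) (X := annihilatedBy S M p.asIdeal)
    have hQp := eq_of_mem_coassociatedPrimes_annihilatedBy hM hQ
    subst hQp
    ext P'
    constructor
    · rintro ⟨P'', hP'', rfl⟩
      rwa [hcomap _ hP'']
    · intro hP'
      exact ⟨P, hP, (hcomap P hP).trans (eq_of_mem_coassociatedPrimes_annihilatedBy hM hP').symm⟩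

theorem exists_mem_coassociatedPrimes_annihilatedBy [IsNoetherianRing R] [Module.Finite R L]
    (hM : Module.Baer R M) {P : PrimeSpectrum S} (hP : P ∈ coassociatedPrimes S (L →ₗ[R] M)) :
    P ∈ coassociatedPrimes S (annihilatedBy S M (P.asIdeal.comap (algebraMap R S))) := by
  -- Any such `p` is forced to be the contraction of `P`, so it is enough to find one along a prime
  -- filtration of `L`.
  suffices H : ∃ p : PrimeSpectrum R, P ∈ coassociatedPrimes S (annihilatedBy S M p.asIdeal) by
    obtain ⟨p, hp⟩ := H
    rwa [comap_eq_of_mem_coassociatedPrimes hM p.isPrime hp]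
  revert hP
  induction ‹Module.Finite R L› using
    IsNoetherianRing.induction_on_isQuotientEquivQuotientPrime R with
  | subsingleton N =>
    intro hP
    rw [coassociatedPrimes_eq_empty] at hP
    exact hP.elim
  | quotient N p e =>
    intro hP
    refine ⟨p, ?_⟩
    rw [← coassociatedPrimes_eq_of_equiv (homQuotientEquivAnnihilatedBy S M p.asIdeal)]
    exact coassociatedPrimes_subset_of_surjective
      (hM.lcomp_surjective (S := S) (f := e.toLinearMap) e.injective) hP
  | exact N₁ N₂ N₃ f g hf hg hfg h₁ h₃ =>
    intro hP
    exact (coassociatedPrimes_subset_union_of_exact (hM.lcomp_surjective (S := S) hf)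
      (lcomp_exact hg hfg) hP).elim h₃ h₁

/-- The elements of `L` that vanish in the localization at the prime `q`. -/
def localizationKernel (L : Type*) [AddCommGroup L] [Module R L] (q : Ideal R) [q.IsPrime] :
    Submodule R L where
  carrier := {y | ∃ s ∉ q, s • y = 0}
  zero_mem' := ⟨1, (Ideal.ne_top_iff_one q).mp (Ideal.IsPrime.ne_top ‹_›), smul_zero _⟩
  add_mem' := by
    rintro y z ⟨s, hs, hy⟩ ⟨t, ht, hz⟩
    refine ⟨s * t, fun h => (Ideal.IsPrime.mem_or_mem ‹_› h).elim hs ht, ?_⟩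
    rw [smul_add, mul_smul, mul_smul, hz, smul_comm, hy, smul_zero, smul_zero, add_zero]
  smul_mem' := by
    rintro c y ⟨s, hs, hy⟩
    exact ⟨s, hs, by rw [smul_comm, hy, smul_zero]⟩

theorem exists_notMem_smul_localizationKernel_eq_zero [IsNoetherianRing R] [Module.Finite R L]
    (q : Ideal R) [hq : q.IsPrime] : ∃ s ∉ q, ∀ y ∈ localizationKernel L q, s • y = 0 := by
  classical
  obtain ⟨F, hF⟩ := IsNoetherian.noetherian (localizationKernel L q)
  have hmem : ∀ y : F, ∃ s ∉ q, s • (y : L) = 0 := fun y =>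
    show (y : L) ∈ localizationKernel L q from hF ▸ Submodule.subset_span y.2
  choose s hs hsy using hmem
  refine ⟨∏ y, s y, fun h => ?_, fun y hy => ?_⟩
  · obtain ⟨y, -, hy⟩ := (Ideal.IsPrime.prod_mem_iff).mp h
    exact hs y hy
  · have hle : localizationKernel L q ≤ LinearMap.ker (LinearMap.lsmul R L (∏ y, s y)) := by
      rw [← hF, Submodule.span_le]
      intro z hz
      rw [SetLike.mem_coe, LinearMap.mem_ker, LinearMap.lsmul_apply,
        ← Finset.prod_erase_mul _ _ (Finset.mem_univ (⟨z, hz⟩ : F)), mul_smul, hsy ⟨z, hz⟩,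
        smul_zero]
    exact hle hy

/-- Elements outside `q` are regular on the quotient, so `p ≤ q` and hence `p = q`. If `y`
represents an element with annihilator `q` and `s ∉ q` kills the localization kernel, then `s • y`
has annihilator `q` in `L` itself. -/
theorem mem_associatedPrimes_of_le_quotient_localizationKernel [IsNoetherianRing R]
    [Module.Finite R L] {q p : Ideal R} [hq : q.IsPrime]
    (hp : p ∈ associatedPrimes R (L ⧸ localizationKernel L q)) (hle : q ≤ p) :
    q ∈ associatedPrimes R L := by
  obtain ⟨-, z, hz⟩ := isAssociatedPrime_iff.mp hp
  obtain ⟨y, rfl⟩ := (localizationKernel L q).mkQ_surjective z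
  have hpr := hp.isPrime
  have hmemp : ∀ a, a ∈ p ↔ a • y ∈ localizationKernel L q := by
    intro a
    rw [hz, Submodule.mem_colon_singleton, Submodule.mem_bot, ← map_smul, Submodule.mkQ_apply,
      Submodule.Quotient.mk_eq_zero]
  have hsat : ∀ (t : L), ∀ s ∉ q, s • t ∈ localizationKernel L q → t ∈ localizationKernel L q := by
    rintro t s hs ⟨r, hr, hrt⟩
    exact ⟨r * s, fun h => (hq.mem_or_mem h).elim hr hs, by rw [mul_smul, hrt]⟩
  have hpq : p = q := by
    refine le_antisymm (fun a ha => ?_) hle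
    by_contra haq
    have hy := hsat y a haq ((hmemp a).mp ha)
    refine hpr.ne_top ((Ideal.eq_top_iff_one _).mpr ((hmemp 1).mpr ?_))
    rwa [one_smul]
  subst hpq
  obtain ⟨s, hs, hsk⟩ := exists_notMem_smul_localizationKernel_eq_zero (L := L) p
  refine isAssociatedPrime_iff.mpr ⟨hpr, s • y, ?_⟩
  ext a
  rw [Submodule.mem_colon_singleton, Submodule.mem_bot]
  constructor
  · intro ha
    rw [smul_comm]
    exact hsk _ ((hmemp a).mp ha)
  · intro ha
    rw [hmemp]
    exact ⟨s, hs, by rw [smul_comm, ha]⟩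

theorem comap_mem_associatedPrimes [IsNoetherianRing R] [Module.Finite R L]
    (hM : Module.Baer R M) {P : PrimeSpectrum S} (hP : P ∈ coassociatedPrimes S (L →ₗ[R] M)) :
    P.asIdeal.comap (algebraMap R S) ∈ associatedPrimes R L := by
  set q := P.asIdeal.comap (algebraMap R S) with hqdef
  have hq : q.IsPrime := Ideal.comap_isPrime _ _
  set Γ := localizationKernel L q
  -- Some `s ∉ q` kills `Γ`, hence `Hom_R(Γ, M)`; a coassociated prime of the latter would contract
  -- to an ideal containing `s`.
  have hΓ : P ∉ coassociatedPrimes S (Γ →ₗ[R] M) := by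
    intro h
    obtain ⟨s, hs, hsk⟩ := exists_notMem_smul_localizationKernel_eq_zero (L := L) q
    refine hs (mem_of_smul_eq_zero h fun φ => ?_)
    ext y
    rw [algebraMap_smul, LinearMap.smul_apply, ← map_smul,
      show s • y = 0 from Subtype.ext (hsk y y.2), map_zero, LinearMap.zero_apply]
  have hquot : P ∈ coassociatedPrimes S ((L ⧸ Γ) →ₗ[R] M) :=
    (coassociatedPrimes_subset_union_of_exact
      (hM.lcomp_surjective (S := S) Γ.injective_subtype)
      (lcomp_exact Γ.mkQ_surjective (LinearMap.exact_subtype_mkQ Γ)) hP).resolve_right hΓ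
  have hsub : (q : Set R) ⊆ ⋃ p ∈ associatedPrimes R (L ⧸ Γ), (p : Set R) := by
    intro a ha
    rw [biUnion_associatedPrimes_eq_compl_regular]
    intro hreg
    refine notMem_of_smul_surjective hquot ?_ ha
    rw [algebraMap_smul_surjective_iff]
    exact hM.smul_hom_surjective hreg
  -- Prime avoidance; the two `⊥` fill the slots for indices exempt from primality, which are not
  -- needed as every member is prime.
  obtain ⟨p, hp, hqp⟩ := (Ideal.subset_union_prime_finite
    (associatedPrimes.finite R (L ⧸ Γ)) (f := id) ⊥ ⊥ fun p hp _ _ => hp.isPrime).mp hsub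
  exact mem_associatedPrimes_of_le_quotient_localizationKernel hp hqp

/-- An element `y` with annihilator `p` embeds `R ⧸ p` in `L`; by injectivity, restriction along it
is surjective. -/
theorem coassociatedPrimes_annihilatedBy_subset_hom [IsNoetherianRing R]
    (hM : Module.Baer R M) {p : Ideal R} (hp : p ∈ associatedPrimes R L) :
    coassociatedPrimes S (annihilatedBy S M p) ⊆ coassociatedPrimes S (L →ₗ[R] M) := by
  obtain ⟨-, y, hy⟩ := isAssociatedPrime_iff.mp hp
  have hker : p = LinearMap.ker (LinearMap.toSpanSingleton R L y) := by
    ext a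
    rw [hy, Submodule.mem_colon_singleton, Submodule.mem_bot, LinearMap.mem_ker,
      LinearMap.toSpanSingleton_apply]
  rw [← coassociatedPrimes_eq_of_equiv (homQuotientEquivAnnihilatedBy S M p)]
  refine coassociatedPrimes_subset_of_surjective (hM.lcomp_surjective (S := S)
    (f := Submodule.liftQ p (LinearMap.toSpanSingleton R L y) hker.le) ?_)
  rw [← LinearMap.ker_eq_bot, Submodule.ker_liftQ_eq_bot _ _ _ hker.ge]

end HomInjective

/-- The map `g : R → S` is `algebraMap R S`. The assumption `Small.{x} R` only says that the
universe of `M` is large enough for `Module.Injective`, which tests against modules in that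
universe, to be injectivity; it is automatic if `R` and `M` live in the same universe. -/
theorem theorem4p3 (R : Type u) (S : Type v) (L : Type w) (M : Type x)
    [CommRing R] [IsNoetherianRing R] [CommRing S] [IsNoetherianRing S] [Algebra R S]
    [AddCommGroup L] [Module R L] [Module.Finite R L]
    [AddCommGroup M] [Module R M] [Module S M] [IsScalarTower R S M]
    [Small.{x} R] [Module.Injective R M] :
    (∀ p : PrimeSpectrum R,
      PrimeSpectrum.comap (algebraMap R S) ''
          coassociatedPrimes S (annihilatedBy S M p.asIdeal) =
        coassociatedPrimes R (annihilatedBy S M p.asIdeal) ∧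
      coassociatedPrimes R (annihilatedBy S M p.asIdeal) ⊆ {p}) ∧
    coassociatedPrimes S (L →ₗ[R] M) =
      ⋃ p ∈ associatedPrimes R L, coassociatedPrimes S (annihilatedBy S M p) := by
  have hM : Module.Baer R M := Module.Baer.of_injective ‹_›
  refine ⟨fun p => ⟨comap_image_coassociatedPrimes_annihilatedBy hM p,
    fun P hP => eq_of_mem_coassociatedPrimes_annihilatedBy hM hP⟩, ?_⟩
  refine Set.Subset.antisymm (fun P hP => ?_) ?_
  · exact Set.mem_biUnion (comap_mem_associatedPrimes hM hP)
      (exists_mem_coassociatedPrimes_annihilatedBy hM hP)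
  · exact Set.iUnion₂_subset fun p hp => coassociatedPrimes_annihilatedBy_subset_hom hM hp
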